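/- Let $n\ge 4$ and let $(M,g)$ be a generalized Robertson–Walker (GRW) spacetime of dimension $n$: a smooth Lorentzian manifold of signature $(+,\dots,+,-)$ which is presented as a warped product $J\times N$ of an open interval $J\subseteq\mathbb R$ and a Riemannian manifold $(N,h)$ of dimension $n-1$, with metric $g=-dt\otimes dt+a(t)^2h$ for a smooth function $a>0$ on $J$. Let $\rho=\partial_t$ be its unit timelike vector field, let $\eta=g(\cdot,\rho)$, and let $S$ and $r$ denote the Ricci tensor and the scalar curvature of $g$. Assume that the Ricci eigenvalue $\xi$ of $\rho$, given by $S(\cdot,\rho)=\xi\,\eta$, is non-zero (it suffices that $S(\cdot,\rho)$ does not vanish identically on $M$). Suppose that $(M,g)$ admits a gradient $\tau$-Einstein soliton, i.e. there are a smooth function $f:M\to\mathbb R$ and real constants $\lambda,\tau$ with $$\nabla^2 f+S=(\lambda+\tau r)\,g ,$$ and that $\rho f$ is constant on $M$. Then $(M,g)$ is a perfect-fluid spacetime with velocity field $\rho$: $\rho$ is a smooth unit timelike vector field, $S$ is not identically zero, and there are smooth functions $a_1,b_1$ on $M$ such that $$S=a_1\,g+b_1\,\eta\otimes\eta .$$ 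-/

import Mathlib

open scoped Manifold ContDiff

noncomputable section

namespace GRW

/-- Coordinate space `ℝⁿ`. -/
abbrev Coord (n : ℕ) : Type := EuclideanSpace ℝ (Fin n)

/-! ### Metric geometry in coordinates

`G : ℝⁿ → (bilinear forms on ℝⁿ)` is the coordinate expression of a metric. -/

/-- The Christoffel symbols as a vector: `Γ(u, v)` is the vector determined by
`2 G(Γ(u, v), w) = (D_u G)(v, w) + (D_v G)(u, w) - (D_w G)(u, v)` for all `w`. -/
def christoffel {n : ℕ} (G : Coord n → Coord n →L[ℝ] Coord n →L[ℝ] ℝ)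
    (x u v : Coord n) : Coord n :=
  (G x).inverse ((1 / 2 : ℝ) •
    (fderiv ℝ G x u v + fderiv ℝ G x v u - ((fderiv ℝ G x).flip u).flip v))

/-- The Riemann curvature
`R(u, v)w = ∇_u ∇_v w - ∇_v ∇_u w - ∇_[u, v] w` for constant coordinate fields `u, v, w`. -/
def curvature {n : ℕ} (G : Coord n → Coord n →L[ℝ] Coord n →L[ℝ] ℝ)
    (x u v w : Coord n) : Coord n :=
  fderiv ℝ (fun y => christoffel G y v w) x u - fderiv ℝ (fun y => christoffel G y u w) x v
    + christoffel G x u (christoffel G x v w) - christoffel G x v (christoffel G x u w)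

/-- The Ricci tensor `Ric(v, w) = trace (u ↦ R(u, v)w)`. -/
def ricciCoord {n : ℕ} (G : Coord n → Coord n →L[ℝ] Coord n →L[ℝ] ℝ)
    (x v w : Coord n) : ℝ :=
  ∑ i : Fin n, curvature G x (EuclideanSpace.single i 1) v w i

/-- The scalar curvature `r = g^{ij} Ric_{ij}`; the vector `(G x)⁻¹ (dxʲ)` has
`i`-th component `g^{ij}`. -/
def scalarCoord {n : ℕ} (G : Coord n → Coord n →L[ℝ] Coord n →L[ℝ] ℝ) (x : Coord n) : ℝ :=
  ∑ i : Fin n, ∑ j : Fin n,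
    (G x).inverse (EuclideanSpace.proj j) i *
      ricciCoord G x (EuclideanSpace.single i 1) (EuclideanSpace.single j 1)

/-- The Hessian `(∇²F)(v, w) = D²F(v, w) - DF(Γ(v, w))`. -/
def hessCoord {n : ℕ} (G : Coord n → Coord n →L[ℝ] Coord n →L[ℝ] ℝ)
    (F : Coord n → ℝ) (x v w : Coord n) : ℝ :=
  fderiv ℝ (fun y => fderiv ℝ F y w) x v - fderiv ℝ F x (christoffel G x v w)

/-! ### Lorentzian manifolds -/

/-- The derivative `v f = df_p(v)` of a real function along a tangent vector. -/
def dirDeriv {n : ℕ} {M : Type*} [TopologicalSpace M] [ChartedSpace (Coord n) M]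
    (f : M → ℝ) (p : M) (v : TangentSpace (𝓡 n) p) : ℝ :=
  mfderiv (𝓡 n) 𝓘(ℝ, ℝ) f p v

/-- A smooth Lorentzian metric on an `n`-manifold, of signature `(+, …, +, -)`: at every point
there is a timelike vector whose orthogonal complement is positive definite. -/
structure LorentzianMetric (n : ℕ) (M : Type*) [TopologicalSpace M]
    [ChartedSpace (Coord n) M] [IsManifold (𝓡 n) ∞ M] where
  /-- The bilinear form on each tangent space. -/
  inner (p : M) : TangentSpace (𝓡 n) p →L[ℝ] TangentSpace (𝓡 n) p →L[ℝ] ℝ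
  symm (p : M) (v w : TangentSpace (𝓡 n) p) : inner p v w = inner p w v
  signature (p : M) : ∃ e : TangentSpace (𝓡 n) p, inner p e e < 0 ∧
    ∀ w : TangentSpace (𝓡 n) p, inner p e w = 0 → w ≠ 0 → 0 < inner p w w
  contMDiff : ContMDiff (𝓡 n) ((𝓡 n).prod 𝓘(ℝ, Coord n →L[ℝ] Coord n →L[ℝ] ℝ)) ∞
    (fun p => Bundle.TotalSpace.mk' (Coord n →L[ℝ] Coord n →L[ℝ] ℝ)
      (E := fun p : M => TangentSpace (𝓡 n) p →L[ℝ] TangentSpace (𝓡 n) p →L[ℝ] ℝ)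
      p (inner p))

section Lorentzian

variable {n : ℕ} {M : Type*} [TopologicalSpace M] [ChartedSpace (Coord n) M]
  [IsManifold (𝓡 n) ∞ M]

/-- The coordinate expression of the metric in the preferred chart `φ` at `p`, that is, the
pullback of the metric by `φ⁻¹`. -/
def LorentzianMetric.inChart (g : LorentzianMetric n M) (p : M) (x : Coord n) :
    Coord n →L[ℝ] Coord n →L[ℝ] ℝ :=
  let B : Coord n →L[ℝ] Coord n →L[ℝ] ℝ := g.inner ((extChartAt (𝓡 n) p).symm x)
  let L : Coord n →L[ℝ] Coord n :=
    mfderiv 𝓘(ℝ, Coord n) (𝓡 n) (extChartAt (𝓡 n) p).symm x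
  B.bilinearComp L L

/-- The Ricci tensor `S` at `p`, computed in the preferred chart at `p`. (Mathlib's tangent space
at `p` is the coordinate space of that chart.) -/
def LorentzianMetric.ricci (g : LorentzianMetric n M) (p : M)
    (v w : TangentSpace (𝓡 n) p) : ℝ :=
  ricciCoord (g.inChart p) (extChartAt (𝓡 n) p p) v w

/-- The scalar curvature `r` at `p`. -/
def LorentzianMetric.scalar (g : LorentzianMetric n M) (p : M) : ℝ :=
  scalarCoord (g.inChart p) (extChartAt (𝓡 n) p p)

/-- The Hessian `∇²f` at `p`. -/
def LorentzianMetric.hess (g : LorentzianMetric n M) (f : M → ℝ) (p : M)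
    (v w : TangentSpace (𝓡 n) p) : ℝ :=
  hessCoord (g.inChart p) (f ∘ (extChartAt (𝓡 n) p).symm) (extChartAt (𝓡 n) p p) v w

/-- `(g, f, lam, τ)` is a gradient `τ`-Einstein soliton: `f` is smooth, `lam` and `τ` are real
constants, and `∇²f + S = (lam + τ r) g`. -/
def IsGradientTauEinsteinSoliton (g : LorentzianMetric n M) (f : M → ℝ) (lam τ : ℝ) : Prop :=
  ContMDiff (𝓡 n) 𝓘(ℝ, ℝ) ∞ f ∧
    ∀ (p : M) (v w : TangentSpace (𝓡 n) p),
      g.hess f p v w + g.ricci p v w = (lam + τ * g.scalar p) * g.inner p v w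

/-- `(M, g)` is a perfect-fluid spacetime with velocity field `ρ`: `ρ` is a smooth unit timelike
vector field, the Ricci tensor does not vanish identically, and `S = a₁ g + b₁ η ⊗ η` for some
scalar fields `a₁`, `b₁`, where `η = g(·, ρ)`. -/
def IsPerfectFluid (g : LorentzianMetric n M) (ρ : (p : M) → TangentSpace (𝓡 n) p) : Prop :=
  ContMDiff (𝓡 n) (𝓡 n).tangent ∞ (fun p => (⟨p, ρ p⟩ : TangentBundle (𝓡 n) M)) ∧
  (∀ p, g.inner p (ρ p) (ρ p) = -1) ∧
  (∃ (p : M) (v w : TangentSpace (𝓡 n) p), g.ricci p v w ≠ 0) ∧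
  ∃ a₁ b₁ : M → ℝ, ContMDiff (𝓡 n) 𝓘(ℝ, ℝ) ∞ a₁ ∧ ContMDiff (𝓡 n) 𝓘(ℝ, ℝ) ∞ b₁ ∧
    ∀ (p : M) (v w : TangentSpace (𝓡 n) p),
      g.ricci p v w = a₁ p * g.inner p v w + b₁ p * (g.inner p v (ρ p) * g.inner p w (ρ p))

end Lorentzian

/-! ### Generalized Robertson-Walker spacetimes -/

/-- A generalized Robertson-Walker structure on the Lorentzian manifold `(M, g)` of dimension `n`:
a presentation `M ≅ -J ×_{a²} N` as a warped product of an open interval `J ⊆ ℝ` and a Riemannian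
manifold `(N, h)` of dimension `n - 1`, with a smooth positive warping function `a` on `J`:
under the diffeomorphism `Φ = (t, π) : M → J × N`,
`g = - dt ⊗ dt + a(t)² π^* h`. -/
structure GRWStructure {n : ℕ} {M : Type*} [TopologicalSpace M] [ChartedSpace (Coord n) M]
    [IsManifold (𝓡 n) ∞ M] (g : LorentzianMetric n M)
    (N : Type*) [TopologicalSpace N] [ChartedSpace (Coord (n - 1)) N]
    [IsManifold (𝓡 (n - 1)) ∞ N] where
  /-- The time interval. -/
  J : TopologicalSpace.Opens ℝ
  ordConnected : (J : Set ℝ).OrdConnected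
  /-- The Riemannian metric of the fibre. -/
  h : Bundle.ContMDiffRiemannianMetric (𝓡 (n - 1)) ∞ (Coord (n - 1))
    (fun x : N => TangentSpace (𝓡 (n - 1)) x)
  /-- The warping function (only its values on `J` matter). -/
  a : ℝ → ℝ
  a_smooth : ContDiffOn ℝ ∞ a J
  a_pos : ∀ s ∈ J, 0 < a s
  /-- The identification of `M` with `J × N`. -/
  Φ : M ≃ₘ⟮𝓡 n, 𝓘(ℝ, ℝ).prod (𝓡 (n - 1))⟯ (J × N)
  metric_eq : ∀ (p : M) (v w : TangentSpace (𝓡 n) p),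
    g.inner p v w =
      - (dirDeriv (fun q => ((Φ q).1 : ℝ)) p v * dirDeriv (fun q => ((Φ q).1 : ℝ)) p w)
      + a (Φ p).1 ^ 2 *
        h.inner (Φ p).2 (mfderiv (𝓡 n) (𝓡 (n - 1)) (fun q => (Φ q).2) p v)
          (mfderiv (𝓡 n) (𝓡 (n - 1)) (fun q => (Φ q).2) p w)

/-- The vector field `ρ = ∂_t` of a generalized Robertson-Walker structure: the image of
`(1, 0) ∈ T_t J × T_x N` under the differential of `Φ⁻¹`. -/
def GRWStructure.timeField {n : ℕ} {M : Type*} [TopologicalSpace M] [ChartedSpace (Coord n) M]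
    [IsManifold (𝓡 n) ∞ M] {g : LorentzianMetric n M}
    {N : Type*} [TopologicalSpace N] [ChartedSpace (Coord (n - 1)) N]
    [IsManifold (𝓡 (n - 1)) ∞ N] (W : GRWStructure g N) (p : M) : TangentSpace (𝓡 n) p :=
  let e : TangentSpace (𝓘(ℝ, ℝ).prod (𝓡 (n - 1))) (W.Φ p) := ((1 : ℝ), (0 : Coord (n - 1)))
  (mfderiv (𝓘(ℝ, ℝ).prod (𝓡 (n - 1))) (𝓡 n) W.Φ.symm (W.Φ p) e : Coord n)

end GRW

end

namespace GRW

set_option maxSynthPendingDepth 3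

/-! ### Pseudo-Riemannian geometry in coordinates -/

/-! Write `H = a'/a`. The field `ρ = ∂_t` is minus the gradient of `t`, so `η = -dt` is closed, and
the warped product gives `L_ρ g = 2H (g + dt ⊗ dt)`. Together these say that `ρ` is torse-forming:
`∇_u ρ = H (u + η(u) ρ)` (`covariant_deriv_field`). Differentiating once more yields `S(·, ρ) = (n -
1)(H' + H²) η` (`ricciCoord_field`), and since `ρ f = c` is constant, `∇²f(v, ρ) = -df(∇_v ρ) = -H
(df - c dt)(v)` (`hessCoord_field`).

Put `ρ` in one slot of the soliton equation. The other slot `ρ` gives `lam + τ r = (n - 1)(H' +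
H²)`, and what remains is `H (df - c dt) = 0`. Since `S(·, ρ)` is not identically zero, `H(s₀) ≠ 0`
for some `s₀`, so `df = c dt` on the slice `t = s₀`. But `f - c t` is constant along the time lines,
hence pulled back from the fibre, and the identity spreads from one slice to all of `M`
(`dirDeriv_eq_of_slice`). Zeros of `H` elsewhere are therefore harmless. Finally `∇²f = c ∇dt = -cH
(g + η ⊗ η)`, and the soliton equation becomes the perfect-fluid form.

The local identities are proved for a metric on an open set of `ℝⁿ`; `timePatch` supplies such a
model around each point, and evaluation at the chart centre returns them to `M`. -/

theorem isInvertible_of_separating {E : Type*} [NormedAddCommGroup E] [NormedSpace ℝ E]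
    [FiniteDimensional ℝ E] {B : E →L[ℝ] E →L[ℝ] ℝ}
    (hB : ∀ v, (∀ w, B v w = 0) → v = 0) : B.IsInvertible := by
  have hinj : Function.Injective (B : E →ₗ[ℝ] E →L[ℝ] ℝ) := by
    rw [injective_iff_map_eq_zero]
    intro v hv
    apply hB
    intro w
    have : B v = 0 := hv
    simp [this]
  have hrank : Module.finrank ℝ E = Module.finrank ℝ (E →L[ℝ] ℝ) := by
    rw [← (LinearMap.toContinuousLinearMap (𝕜 := ℝ) (E := E) (F' := ℝ)).finrank_eq]
    exact (Subspace.dual_finrank_eq (K := ℝ) (V := E)).symm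
  refine ⟨(LinearEquiv.ofInjectiveOfFinrankEq (B : E →ₗ[ℝ] E →L[ℝ] ℝ)
    hinj hrank).toContinuousLinearEquiv, ?_⟩
  ext v w
  rfl

section Coordinates

variable {n : ℕ} {U : Set (Coord n)} {G : Coord n → Coord n →L[ℝ] Coord n →L[ℝ] ℝ}
  {t : Coord n → ℝ} {ρ : Coord n → Coord n} {φ : Coord n → ℝ} {x : Coord n}

theorem apply_inverse_of_isInvertible {B : Coord n →L[ℝ] Coord n →L[ℝ] ℝ} (hB : B.IsInvertible)
    (l : Coord n →L[ℝ] ℝ) : B (B.inverse l) = l := by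
  obtain ⟨e, rfl⟩ := hB
  simp

theorem koszul (hG : (G x).IsInvertible) (u v w : Coord n) :
    2 * G x (christoffel G x u v) w
      = fderiv ℝ G x u v w + fderiv ℝ G x v u w - fderiv ℝ G x w u v := by
  rw [christoffel, apply_inverse_of_isInvertible hG]
  simp

/-- The Christoffel symbols as a bilinear map. -/
noncomputable def christoffelL (G : Coord n → Coord n →L[ℝ] Coord n →L[ℝ] ℝ) (x : Coord n) :
    Coord n →L[ℝ] Coord n →L[ℝ] Coord n :=
  (ContinuousLinearMap.compL ℝ (Coord n) (Coord n →L[ℝ] ℝ) (Coord n) (G x).inverse).comp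
    ((1 / 2 : ℝ) • (fderiv ℝ G x + (fderiv ℝ G x).flip -
      (ContinuousLinearMap.flipₗᵢ ℝ (Coord n) (Coord n)
        ℝ).toContinuousLinearEquiv.toContinuousLinearMap.comp (fderiv ℝ G x).flip))

theorem christoffelL_apply (u v : Coord n) : christoffelL G x u v = christoffel G x u v := by
  simp only [christoffelL, christoffel]
  rfl

theorem contDiffOn_christoffelL (hU : IsOpen U) (hG : ContDiffOn ℝ ∞ G U)
    (hinv : ∀ y ∈ U, (G y).IsInvertible) : ContDiffOn ℝ ∞ (christoffelL G) U := by
  have h1 : ContDiffOn ℝ ∞ (fun y => (G y).inverse) U := by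
    intro y hy
    exact ((hinv y hy).contDiffAt_map_inverse).comp_contDiffWithinAt y (hG y hy)
  have h2 : ContDiffOn ℝ ∞ (fderiv ℝ G) U := hG.fderiv_of_isOpen hU (by simp)
  have h3 : ContDiffOn ℝ ∞ (fun y => (fderiv ℝ G y).flip) U :=
    (ContinuousLinearMap.flipₗᵢ ℝ (Coord n) (Coord n)
      (Coord n →L[ℝ] ℝ)).contDiff.comp_contDiffOn h2
  unfold christoffelL
  refine ContDiffOn.clm_comp
    ((ContinuousLinearMap.compL ℝ (Coord n) (Coord n →L[ℝ] ℝ) (Coord n)).contDiff.comp_contDiffOn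
      h1) ?_
  exact ((h2.add h3).sub (contDiffOn_const.clm_comp h3)).const_smul (1 / 2 : ℝ)

theorem fderiv_symm_of_symm (hU : IsOpen U) (hG : DifferentiableOn ℝ G U)
    (hsymm : ∀ y ∈ U, ∀ v w, G y v w = G y w v) (hx : x ∈ U) (u v w : Coord n) :
    fderiv ℝ G x u v w = fderiv ℝ G x u w v := by
  have hd := (hG.differentiableAt (hU.mem_nhds hx)).hasFDerivAt
  have h1 := (hd.clm_apply (hasFDerivAt_const v x)).clm_apply (hasFDerivAt_const w x)
  have h2 := (hd.clm_apply (hasFDerivAt_const w x)).clm_apply (hasFDerivAt_const v x)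
  have h3 := h1.congr_of_eventuallyEq (f₁ := fun y => G y w v) (by
    filter_upwards [hU.mem_nhds hx] with y hy using hsymm y hy w v)
  simpa using congrArg (fun l => l u) (h3.unique h2)

theorem christoffel_symm (hU : IsOpen U) (hG : DifferentiableOn ℝ G U)
    (hsymm : ∀ y ∈ U, ∀ v w, G y v w = G y w v) (hx : x ∈ U) (u v : Coord n) :
    christoffel G x u v = christoffel G x v u := by
  unfold christoffel
  congr 2
  ext w
  simp only [add_apply, sub_apply,
    ContinuousLinearMap.flip_apply]
  rw [fderiv_symm_of_symm hU hG hsymm hx w u v]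
  ring

/-- A coordinate patch `U` with a metric `G`, a time function `t` and its (negative) gradient
field `ρ`, normalised by `ρ t = 1`, such that `L_ρ G = 2 φ (G + dt ⊗ dt)`. -/
structure TimePatch (U : Set (Coord n)) (G : Coord n → Coord n →L[ℝ] Coord n →L[ℝ] ℝ)
    (t : Coord n → ℝ) (ρ : Coord n → Coord n) (φ : Coord n → ℝ) : Prop where
  isOpen : IsOpen U
  contDiffOn_metric : ContDiffOn ℝ ∞ G U
  contDiffOn_time : ContDiffOn ℝ ∞ t U
  contDiffOn_field : ContDiffOn ℝ ∞ ρ U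
  symm : ∀ y ∈ U, ∀ v w, G y v w = G y w v
  invertible : ∀ y ∈ U, (G y).IsInvertible
  flat : ∀ y ∈ U, ∀ w, G y (ρ y) w = - fderiv ℝ t y w
  field_time : ∀ y ∈ U, fderiv ℝ t y (ρ y) = 1
  lie : ∀ y ∈ U, ∀ u w, fderiv ℝ G y (ρ y) u w + G y (fderiv ℝ ρ y u) w
    + G y u (fderiv ℝ ρ y w) = 2 * φ y * (G y u w + fderiv ℝ t y u * fderiv ℝ t y w)

namespace TimePatch

variable (P : TimePatch U G t ρ φ)
include P

theorem hasFDerivAt_metric (hx : x ∈ U) : HasFDerivAt G (fderiv ℝ G x) x :=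
  ((P.contDiffOn_metric.differentiableOn (by simp)).differentiableAt
    (P.isOpen.mem_nhds hx)).hasFDerivAt

theorem hasFDerivAt_field (hx : x ∈ U) : HasFDerivAt ρ (fderiv ℝ ρ x) x :=
  ((P.contDiffOn_field.differentiableOn (by simp)).differentiableAt
    (P.isOpen.mem_nhds hx)).hasFDerivAt

theorem hasFDerivAt_time (hx : x ∈ U) : HasFDerivAt t (fderiv ℝ t x) x :=
  ((P.contDiffOn_time.differentiableOn (by simp)).differentiableAt
    (P.isOpen.mem_nhds hx)).hasFDerivAt

end TimePatch

theorem hasFDerivAt_fderiv {E F : Type*} [NormedAddCommGroup E] [NormedSpace ℝ E]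
    [NormedAddCommGroup F] [NormedSpace ℝ F] {U : Set E} {f : E → F} (hU : IsOpen U)
    (hf : ContDiffOn ℝ ∞ f U) {x : E} (hx : x ∈ U) :
    HasFDerivAt (fderiv ℝ f) (fderiv ℝ (fderiv ℝ f) x) x :=
  (((hf.fderiv_of_isOpen hU (m := ∞) (by simp)).differentiableOn (by simp)).differentiableAt
    (hU.mem_nhds hx)).hasFDerivAt

theorem second_fderiv_symm {E F : Type*} [NormedAddCommGroup E] [NormedSpace ℝ E]
    [NormedAddCommGroup F] [NormedSpace ℝ F] {U : Set E} {f : E → F} (hU : IsOpen U)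
    (hf : ContDiffOn ℝ ∞ f U) {x : E} (hx : x ∈ U) (u v : E) :
    fderiv ℝ (fderiv ℝ f) x u v = fderiv ℝ (fderiv ℝ f) x v u :=
  (hf.contDiffAt (hU.mem_nhds hx)).isSymmSndFDerivAt
    (by simpa using (WithTop.coe_le_coe.2 le_top : ((2 : ℕ∞) : ℕ∞ω) ≤ ((⊤ : ℕ∞) : ℕ∞ω))) u v

/-! ### The torse-forming identity, Hessians and curvature on a time patch. -/

namespace TimePatch

variable (P : TimePatch U G t ρ φ)
include P

/-- Derivative of `flat` along `u`. The right side is symmetric in `u` and `w`, which expresses that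
the metric dual of `ρ` is closed. -/
theorem fderiv_flat (hx : x ∈ U) (u w : Coord n) :
    fderiv ℝ G x u (ρ x) w + G x (fderiv ℝ ρ x u) w = - fderiv ℝ (fderiv ℝ t) x u w := by
  have h1 := ((P.hasFDerivAt_metric hx).clm_apply (P.hasFDerivAt_field hx)).clm_apply
    (hasFDerivAt_const w x)
  have h2 := ((hasFDerivAt_fderiv P.isOpen P.contDiffOn_time hx).clm_apply
    (hasFDerivAt_const w x)).neg
  have h3 := h1.congr_of_eventuallyEq (f₁ := fun y => - fderiv ℝ t y w) (by
    filter_upwards [P.isOpen.mem_nhds hx] with y hy using (P.flat y hy w).symm)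
  have h4 := congrArg (fun l => l u) (h3.unique h2)
  simp at h4
  linarith

/-- `∇_u ρ = φ (u + η(u) ρ)`, where `η = -dt`. -/
theorem covariant_deriv_field (hx : x ∈ U) (u : Coord n) :
    fderiv ℝ ρ x u + christoffel G x u (ρ x) = φ x • (u - fderiv ℝ t x u • ρ x) := by
  have hinj : Function.Injective (G x) := by
    obtain ⟨e, he⟩ := P.invertible x hx
    rw [← he]
    exact e.injective
  apply hinj
  ext w
  have hk := koszul (P.invertible x hx) u (ρ x) w
  have h1 := P.fderiv_flat hx u w
  have h2 := P.fderiv_flat hx w u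
  have h3 := second_fderiv_symm P.isOpen P.contDiffOn_time hx u w
  have h4 := P.lie x hx u w
  have h5 := P.symm x hx u (fderiv ℝ ρ x w)
  have h6 := fderiv_symm_of_symm P.isOpen (P.contDiffOn_metric.differentiableOn (by simp)) P.symm
    hx w u (ρ x)
  have h7 := P.flat x hx w
  simp only [map_add, map_smul, map_sub, add_apply,
    smul_apply, sub_apply, smul_eq_mul, h7]
  -- By Koszul, `2 G(∇_u ρ, w)` is `(L_ρ G)(u, w)` plus the exterior derivative of `η`; the latter
  -- vanishes by `h1`, `h2` and the symmetry `h3` of `D²t`.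
  linarith

/-- The metric dual of `ρ` satisfies `(∇_v η)(w) = φ (G(v, w) + η(v) η(w))`. -/
theorem covariant_deriv_dual (hx : x ∈ U) (v w : Coord n) :
    fderiv ℝ (fderiv ℝ t) x v w - fderiv ℝ t x (christoffel G x v w)
      = - (φ x * (G x v w + fderiv ℝ t x v * fderiv ℝ t x w)) := by
  have h1 := P.fderiv_flat hx v w
  have h2 := P.flat x hx (christoffel G x v w)
  have h3 := P.symm x hx (ρ x) (christoffel G x v w)
  have h4 := koszul (P.invertible x hx) v w (ρ x)
  have h5 := koszul (P.invertible x hx) v (ρ x) w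
  have h6 := fderiv_symm_of_symm P.isOpen (P.contDiffOn_metric.differentiableOn (by simp)) P.symm
    hx v w (ρ x)
  have h7 := fderiv_symm_of_symm P.isOpen (P.contDiffOn_metric.differentiableOn (by simp)) P.symm
    hx w v (ρ x)
  -- Metric compatibility gives `(∇_v η)(w) = G(∇_v ρ, w)`; `h4` and `h5` encode it, and `h8`
  -- evaluates the right side.
  have h8 := congrArg (fun z => G x z w) (P.covariant_deriv_field hx v)
  have h9 := P.flat x hx w
  simp only [map_add, map_smul, map_sub, add_apply,
    smul_apply, sub_apply, smul_eq_mul, h9] at h8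
  linarith

/-- In `∇²F(v, ρ) = v(ρF) - dF(∇_v ρ)` the first term is the derivative of a constant. -/
theorem hessCoord_field {F : Coord n → ℝ} (hF : ContDiffOn ℝ ∞ F U) {c : ℝ}
    (hc : ∀ y ∈ U, fderiv ℝ F y (ρ y) = c) (hx : x ∈ U) (v : Coord n) :
    hessCoord G F x v (ρ x) = - (φ x * (fderiv ℝ F x v - c * fderiv ℝ t x v)) := by
  have h1 := (hasFDerivAt_fderiv P.isOpen hF hx).clm_apply (P.hasFDerivAt_field hx)
  have h2 := h1.congr_of_eventuallyEq (f₁ := fun _ => c) (by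
    filter_upwards [P.isOpen.mem_nhds hx] with y hy using (hc y hy).symm)
  have h3 := congrArg (fun l => l v) (h2.unique (hasFDerivAt_const c x))
  have h4 := congrArg (fderiv ℝ F x) (P.covariant_deriv_field hx v)
  have h5 := ((hasFDerivAt_fderiv P.isOpen hF hx).clm_apply (hasFDerivAt_const (ρ x) x)).fderiv
  rw [hessCoord, h5]
  simp [hc x hx] at h3 h4 ⊢
  linarith

theorem hessCoord_of_fderiv_eq {F : Coord n → ℝ} {c : ℝ}
    (hF : ∀ y ∈ U, ∀ w, fderiv ℝ F y w = c * fderiv ℝ t y w) (hx : x ∈ U) (v w : Coord n) :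
    hessCoord G F x v w = - (c * φ x * (G x v w + fderiv ℝ t x v * fderiv ℝ t x w)) := by
  have h1 := (((hasFDerivAt_fderiv P.isOpen P.contDiffOn_time hx).clm_apply
    (hasFDerivAt_const w x)).const_mul c)
  have h2 := (h1.congr_of_eventuallyEq (f₁ := fun y => fderiv ℝ F y w) (by
    filter_upwards [P.isOpen.mem_nhds hx] with y hy using hF y hy w)).fderiv
  have h3 := P.covariant_deriv_dual hx v w
  rw [hessCoord, h2, hF x hx]
  simp
  linear_combination c * h3

/-- `R(u, v)ρ = (φ' + φ²)(η(v) u - η(u) v)`, where `dφ = φ' dt` and `η = -dt`. -/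
theorem curvature_field {φ' : ℝ} (hx : x ∈ U)
    (hφ : HasFDerivAt φ (φ' • fderiv ℝ t x) x) (u v : Coord n) :
    curvature G x u v (ρ x)
      = (φ' + φ x ^ 2) • (fderiv ℝ t x u • v - fderiv ℝ t x v • u) := by
  have hΓ : HasFDerivAt (christoffelL G) (fderiv ℝ (christoffelL G) x) x :=
    (((contDiffOn_christoffelL P.isOpen P.contDiffOn_metric P.invertible).differentiableOn
      (by simp)).differentiableAt (P.isOpen.mem_nhds hx)).hasFDerivAt
  have hρ := P.hasFDerivAt_field hx
  have hρ2 := hasFDerivAt_fderiv P.isOpen P.contDiffOn_field hx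
  have ht2 := hasFDerivAt_fderiv P.isOpen P.contDiffOn_time hx
  have hdΓ : ∀ a b d : Coord n, fderiv ℝ (fun y => christoffel G y a b) x d
      = fderiv ℝ (christoffelL G) x d a b := by
    intro a b d
    have h := ((hΓ.clm_apply (hasFDerivAt_const a x)).clm_apply (hasFDerivAt_const b x)).fderiv
    simp only [christoffelL_apply] at h
    rw [h]
    simp
  -- The torse-forming identity for the constant vector `a`, differentiated in direction `b`.
  have key : ∀ a b : Coord n, fderiv ℝ (fderiv ℝ ρ) x b a
      + fderiv ℝ (christoffelL G) x b a (ρ x) + christoffelL G x a (fderiv ℝ ρ x b)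
      = (φ' * fderiv ℝ t x b) • (a - fderiv ℝ t x a • ρ x)
        - φ x • (fderiv ℝ (fderiv ℝ t) x b a • ρ x + fderiv ℝ t x a • fderiv ℝ ρ x b) := by
    intro a b
    have h1 := (hρ2.clm_apply (hasFDerivAt_const a x)).add
      ((hΓ.clm_apply (hasFDerivAt_const a x)).clm_apply hρ)
    have h2 := hφ.smul ((hasFDerivAt_const a x).sub
      ((ht2.clm_apply (hasFDerivAt_const a x)).smul hρ))
    have h3 := h1.congr_of_eventuallyEq
      (f₁ := fun y => φ y • (a - fderiv ℝ t y a • ρ y)) (by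
        filter_upwards [P.isOpen.mem_nhds hx] with y hy
        rw [← P.covariant_deriv_field hy a]
        simp [christoffelL_apply])
    have h4 := congrArg (fun l => l b) (h3.unique h2)
    simp at h4
    rw [add_assoc]
    refine Eq.trans ?_ (h4.trans ?_)
    · abel
    · module
  have hcov : ∀ a, christoffelL G x a (ρ x)
      = φ x • (a - fderiv ℝ t x a • ρ x) - fderiv ℝ ρ x a := by
    intro a
    rw [← P.covariant_deriv_field hx a, christoffelL_apply]
    abel
  have hsymm : christoffelL G x u v = christoffelL G x v u := by
    simp only [christoffelL_apply]
    exact christoffel_symm P.isOpen (P.contDiffOn_metric.differentiableOn (by simp)) P.symm hx u v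
  have k1 := key v u
  have k2 := key u v
  have s1 := second_fderiv_symm P.isOpen P.contDiffOn_field hx u v
  have s2 := second_fderiv_symm P.isOpen P.contDiffOn_time hx u v
  -- Solved for the derivative of `Γ` paired with `ρ`. In the antisymmetrisation over `u`, `v` the
  -- second derivatives of `ρ` and `t` cancel, as do the terms `Γ(u, Dρ v)` and `Γ(v, Dρ u)`.
  have e1 : fderiv ℝ (christoffelL G) x u v (ρ x) = _ :=
    eq_sub_of_add_eq' (eq_sub_of_add_eq k1)
  have e2 : fderiv ℝ (christoffelL G) x v u (ρ x) = _ :=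
    eq_sub_of_add_eq' (eq_sub_of_add_eq k2)
  rw [curvature, hdΓ, hdΓ, e1, e2]
  simp only [← christoffelL_apply, hcov, map_sub, map_smul, hsymm, s1, s2]
  module

/-- `Ric(v, ρ) = (n - 1)(φ' + φ²) η(v)`, where `dφ = φ' dt` and `η = -dt`. -/
theorem ricciCoord_field {φ' : ℝ} (hx : x ∈ U)
    (hφ : HasFDerivAt φ (φ' • fderiv ℝ t x) x) (v : Coord n) :
    ricciCoord G x v (ρ x) = - ((n - 1) * (φ' + φ x ^ 2) * fderiv ℝ t x v) := by
  have hv : fderiv ℝ t x v = ∑ i, v i * fderiv ℝ t x (EuclideanSpace.single i 1) := by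
    conv_lhs => rw [← (EuclideanSpace.basisFun (Fin n) ℝ).sum_repr v]
    simp
  -- The trace of `u ↦ dt(u) v - dt(v) u` is `(1 - n) dt(v)`.
  simp only [ricciCoord, P.curvature_field hx hφ]
  simp [← Finset.mul_sum, Finset.sum_sub_distrib]
  have : ∑ i, fderiv ℝ t x (EuclideanSpace.single i 1) * v i = fderiv ℝ t x v := by
    rw [hv]; exact Finset.sum_congr rfl fun i _ => mul_comm _ _
  rw [this]
  ring

end TimePatch

/-- The Lie derivative of a warped product metric along the time field. -/
theorem lie_warped {E' : Type*} [NormedAddCommGroup E'] [NormedSpace ℝ E']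
    {π : Coord n → E'} {h : E' → E' →L[ℝ] E' →L[ℝ] ℝ} {a : ℝ → ℝ} (hU : IsOpen U)
    (hG : DifferentiableOn ℝ G U) (ht : ContDiffOn ℝ ∞ t U) (hπ : ContDiffOn ℝ ∞ π U)
    (hρ : DifferentiableOn ℝ ρ U) (hh : ∀ y ∈ U, DifferentiableAt ℝ h (π y))
    (ha : ∀ y ∈ U, DifferentiableAt ℝ a (t y)) (ha0 : ∀ y ∈ U, a (t y) ≠ 0)
    (hGeq : ∀ y ∈ U, ∀ v w, G y v w = - (fderiv ℝ t y v * fderiv ℝ t y w)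
      + a (t y) ^ 2 * h (π y) (fderiv ℝ π y v) (fderiv ℝ π y w))
    (ht1 : ∀ y ∈ U, fderiv ℝ t y (ρ y) = 1) (hπ0 : ∀ y ∈ U, fderiv ℝ π y (ρ y) = 0)
    (hx : x ∈ U) (u w : Coord n) :
    fderiv ℝ G x (ρ x) u w + G x (fderiv ℝ ρ x u) w + G x u (fderiv ℝ ρ x w)
      = 2 * (deriv a (t x) / a (t x)) * (G x u w + fderiv ℝ t x u * fderiv ℝ t x w) := by
  have hdG := (hG.differentiableAt (hU.mem_nhds hx)).hasFDerivAt
  have hdρ := (hρ.differentiableAt (hU.mem_nhds hx)).hasFDerivAt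
  have hdt := ((ht.differentiableOn (by simp)).differentiableAt (hU.mem_nhds hx)).hasFDerivAt
  have hdπ := ((hπ.differentiableOn (by simp)).differentiableAt (hU.mem_nhds hx)).hasFDerivAt
  have ht2 := hasFDerivAt_fderiv hU ht hx
  have hπ2 := hasFDerivAt_fderiv hU hπ hx
  have hdh := (hh x hx).hasFDerivAt.comp x hdπ
  have hda := (ha x hx).hasDerivAt.comp_hasFDerivAt x hdt
  -- Constancy of `dt(ρ)`, and of `dπ(ρ)` in `e2`, means that `ρ` preserves `dt` and `dπ`. As `h ∘
  -- π` has zero derivative along `ρ`, only the factor `a(t)²` contributes.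
  have e1 : ∀ v, fderiv ℝ (fderiv ℝ t) x (ρ x) v = - fderiv ℝ t x (fderiv ℝ ρ x v) := by
    intro v
    have h1 := (ht2.clm_apply hdρ).congr_of_eventuallyEq (f₁ := fun _ => (1 : ℝ)) (by
      filter_upwards [hU.mem_nhds hx] with y hy using (ht1 y hy).symm)
    have h2 := congrArg (fun l => l v) (h1.unique (hasFDerivAt_const 1 x))
    rw [second_fderiv_symm hU ht hx]
    simp at h2
    linarith
  have e2 : ∀ v, fderiv ℝ (fderiv ℝ π) x (ρ x) v = - fderiv ℝ π x (fderiv ℝ ρ x v) := by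
    intro v
    have h1 := (hπ2.clm_apply hdρ).congr_of_eventuallyEq (f₁ := fun _ => (0 : E')) (by
      filter_upwards [hU.mem_nhds hx] with y hy using (hπ0 y hy).symm)
    have h2 := congrArg (fun l => l v) (h1.unique (hasFDerivAt_const 0 x))
    rw [second_fderiv_symm hU hπ hx]
    simp at h2
    exact eq_neg_of_add_eq_zero_right h2
  have h1 := (hdG.clm_apply (hasFDerivAt_const u x)).clm_apply (hasFDerivAt_const w x)
  have h2 := ((ht2.clm_apply (hasFDerivAt_const u x)).mul
    (ht2.clm_apply (hasFDerivAt_const w x))).neg.add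
    ((hda.pow 2).mul ((hdh.clm_apply (hπ2.clm_apply (hasFDerivAt_const u x))).clm_apply
      (hπ2.clm_apply (hasFDerivAt_const w x))))
  have h3 := h2.congr_of_eventuallyEq (f₁ := fun y => G y u w) (by
    filter_upwards [hU.mem_nhds hx] with y hy
    rw [hGeq y hy]
    rfl)
  have h4 := congrArg (fun l => l (ρ x)) (h1.unique h3)
  simp [e1, e2, ht1 x hx, hπ0 x hx] at h4
  have ha' := ha0 x hx
  rw [h4, hGeq x hx, hGeq x hx, hGeq x hx]
  field_simp
  ring

end Coordinates


/-! ### Charts -/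

/-- The chart of an open subset of `ℝ` is the inclusion itself, so in coordinates the map is the
identity. -/
theorem hasMFDerivAt_opens_val (J : TopologicalSpace.Opens ℝ) (s : J) :
    HasMFDerivAt 𝓘(ℝ, ℝ) 𝓘(ℝ, ℝ) (Subtype.val : J → ℝ) s (ContinuousLinearMap.id ℝ ℝ) := by
  refine ⟨continuous_subtype_val.continuousAt, ?_⟩
  refine HasFDerivWithinAt.congr_of_eventuallyEq (hasFDerivWithinAt_id (𝕜 := ℝ) _ _) ?_ ?_
  · filter_upwards [extChartAt_target_mem_nhdsWithin (I := 𝓘(ℝ, ℝ)) s] with z hz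
    exact (extChartAt 𝓘(ℝ, ℝ) s).right_inv hz
  · exact (extChartAt 𝓘(ℝ, ℝ) s).right_inv (mem_extChartAt_target s)

theorem contMDiffOn_section_iff {E : Type*} [NormedAddCommGroup E] [NormedSpace ℝ E] {V : E → E}
    {U : Set E} : ContMDiffOn 𝓘(ℝ, E) 𝓘(ℝ, E).tangent ∞
      (fun x : E => (⟨x, V x⟩ : TangentBundle 𝓘(ℝ, E) E)) U ↔ ContDiffOn ℝ ∞ V U :=
  contMDiffOn_vectorSpace_iff_contDiffOn

section Charts

variable {n : ℕ} {M : Type*} [TopologicalSpace M] [ChartedSpace (Coord n) M]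
  [IsManifold (𝓡 n) ∞ M]

theorem isManifold_one : IsManifold (𝓡 n) 1 M := IsManifold.of_le (n := ∞) (by simp)

/-- The derivative of the inverse of the preferred chart at `p`. -/
noncomputable def chartFrame (p : M) (x : Coord n) :
    Coord n →L[ℝ] Coord n :=
  mfderiv 𝓘(ℝ, Coord n) (𝓡 n) (extChartAt (𝓡 n) p).symm x

theorem mdifferentiableAt_chart_symm {p : M} {x : Coord n}
    (hx : x ∈ (extChartAt (𝓡 n) p).target) :
    MDifferentiableAt 𝓘(ℝ, Coord n) (𝓡 n) (extChartAt (𝓡 n) p).symm x := by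
  have : IsManifold (𝓡 n) 1 M := isManifold_one
  have := mdifferentiableWithinAt_extChartAt_symm hx
  rwa [ModelWithCorners.range_eq_univ, mdifferentiableWithinAt_univ] at this

theorem contMDiffOn_chart_symm (p : M) :
    ContMDiffOn 𝓘(ℝ, Coord n) (𝓡 n) ∞ (extChartAt (𝓡 n) p).symm
      (extChartAt (𝓡 n) p).target :=
  contMDiffOn_extChartAt_symm p

theorem isInvertible_chartFrame {p : M} {x : Coord n}
    (hx : x ∈ (extChartAt (𝓡 n) p).target) : (chartFrame p x).IsInvertible := by
  have : IsManifold (𝓡 n) 1 M := isManifold_one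
  have := isInvertible_mfderivWithin_extChartAt_symm hx
  rwa [ModelWithCorners.range_eq_univ, mfderivWithin_univ] at this

/-- The tangent space at `p` is the model space of the preferred chart at `p`, in which the inverse
chart reads as the identity. Hence coordinate identities at the centre are identities on
`TangentSpace (𝓡 n) p`. -/
theorem chartFrame_self (p : M) :
    chartFrame p (extChartAt (𝓡 n) p p) = ContinuousLinearMap.id ℝ (Coord n) := by
  have hx : extChartAt (𝓡 n) p p ∈ (extChartAt (𝓡 n) p).target := mem_extChartAt_target p
  have h : HasMFDerivAt 𝓘(ℝ, Coord n) (𝓡 n) (extChartAt (𝓡 n) p).symm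
      (extChartAt (𝓡 n) p p) (ContinuousLinearMap.id ℝ (Coord n)) := by
    have hcenter : (extChartAt (𝓡 n) p).symm (extChartAt (𝓡 n) p p) = p :=
      (extChartAt (𝓡 n) p).left_inv (mem_extChartAt_source p)
    have hz : ∀ z ∈ (extChartAt (𝓡 n) p).target,
        writtenInExtChartAt 𝓘(ℝ, Coord n) (𝓡 n) (extChartAt (𝓡 n) p p)
          (extChartAt (𝓡 n) p).symm z = z := by
      intro z hz
      simp only [writtenInExtChartAt, Function.comp_apply, extChartAt_model_space_eq_id,
        PartialEquiv.refl_symm, PartialEquiv.refl_coe, id_eq]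
      rw [hcenter]
      exact (extChartAt (𝓡 n) p).right_inv hz
    refine ⟨(mdifferentiableAt_chart_symm hx).continuousAt, ?_⟩
    refine HasFDerivWithinAt.congr_of_eventuallyEq (hasFDerivWithinAt_id (𝕜 := ℝ) _ _) ?_ ?_
    · filter_upwards [mem_nhdsWithin_of_mem_nhds ((isOpen_extChartAt_target p).mem_nhds hx)] with z h
      exact hz z h
    · exact hz _ hx
  exact h.mfderiv

theorem fderiv_comp_chart_symm {E' : Type*} [NormedAddCommGroup E'] [NormedSpace ℝ E']
    {f : M → E'} {p : M} {x : Coord n} (hx : x ∈ (extChartAt (𝓡 n) p).target)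
    (hf : MDifferentiableAt (𝓡 n) 𝓘(ℝ, E') f ((extChartAt (𝓡 n) p).symm x)) (v : Coord n) :
    fderiv ℝ (f ∘ (extChartAt (𝓡 n) p).symm) x v
      = (mfderiv (𝓡 n) 𝓘(ℝ, E') f ((extChartAt (𝓡 n) p).symm x) (chartFrame p x v) : E') := by
  rw [← mfderiv_eq_fderiv, mfderiv_comp x hf (mdifferentiableAt_chart_symm hx)]
  rfl

theorem contDiffOn_comp_chart_symm {E' : Type*} [NormedAddCommGroup E'] [NormedSpace ℝ E']
    {f : M → E'} (hf : ContMDiff (𝓡 n) 𝓘(ℝ, E') ∞ f) (p : M) :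
    ContDiffOn ℝ ∞ (f ∘ (extChartAt (𝓡 n) p).symm) (extChartAt (𝓡 n) p).target :=
  (hf.comp_contMDiffOn (contMDiffOn_chart_symm (n := n) p)).contDiffOn

/-- A section of the tangent bundle obtained as the tangent map of the smooth inverse chart applied
to a smooth section. It serves both for metric coefficients and for the smoothness of `ρ`. -/
theorem contMDiffOn_chartFrame (p : M) {V : Coord n → Coord n} {U : Set (Coord n)}
    (hU : U ⊆ (extChartAt (𝓡 n) p).target) (hV : ContDiffOn ℝ ∞ V U) :
    ContMDiffOn 𝓘(ℝ, Coord n) (𝓡 n).tangent ∞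
      (fun x => (⟨(extChartAt (𝓡 n) p).symm x, chartFrame p x (V x)⟩ : TangentBundle (𝓡 n) M))
      U := by
  have ho := isOpen_extChartAt_target (I := 𝓡 n) p
  have h1 := (contMDiffOn_chart_symm p).contMDiffOn_tangentMapWithin (m := ∞) (by simp)
    ho.uniqueMDiffOn
  have h2 : ContMDiffOn 𝓘(ℝ, Coord n) 𝓘(ℝ, Coord n).tangent ∞
      (fun x : Coord n => (⟨x, V x⟩ : TangentBundle 𝓘(ℝ, Coord n) (Coord n))) U :=
    contMDiffOn_section_iff.2 hV
  refine (h1.comp h2 (fun x hx => hU hx)).congr fun x hx => ?_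
  simp only [Function.comp_apply, tangentMapWithin, chartFrame]
  rw [mfderivWithin_of_isOpen ho (hU hx)]
  rfl

/-- The coordinate expression of a field of bilinear forms in the preferred chart at `p`. -/
noncomputable def bilinearInChart
    (B : ∀ q : M, TangentSpace (𝓡 n) q →L[ℝ] TangentSpace (𝓡 n) q →L[ℝ] ℝ) (p : M)
    (x : Coord n) : Coord n →L[ℝ] Coord n →L[ℝ] ℝ :=
  let b : Coord n →L[ℝ] Coord n →L[ℝ] ℝ := B ((extChartAt (𝓡 n) p).symm x)
  b.bilinearComp (chartFrame p x) (chartFrame p x)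

/-- The coordinate expression of a smooth field of bilinear forms is smooth. -/
theorem contDiffOn_bilinear
    {B : ∀ q : M, TangentSpace (𝓡 n) q →L[ℝ] TangentSpace (𝓡 n) q →L[ℝ] ℝ}
    (hB : ContMDiff (𝓡 n) ((𝓡 n).prod 𝓘(ℝ, Coord n →L[ℝ] Coord n →L[ℝ] ℝ)) ∞
      (fun p => Bundle.TotalSpace.mk' (Coord n →L[ℝ] Coord n →L[ℝ] ℝ)
        (E := fun p : M => TangentSpace (𝓡 n) p →L[ℝ] TangentSpace (𝓡 n) p →L[ℝ] ℝ)
        p (B p))) (p : M) :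
    ContDiffOn ℝ ∞ (bilinearInChart B p) (extChartAt (𝓡 n) p).target := by
  rw [contDiffOn_clm_apply]
  intro v
  rw [contDiffOn_clm_apply]
  intro w
  have h : ContMDiffOn 𝓘(ℝ, Coord n) ((𝓡 n).prod 𝓘(ℝ, ℝ)) ∞
      (fun x => Bundle.TotalSpace.mk' ℝ (E := Bundle.Trivial M ℝ) ((extChartAt (𝓡 n) p).symm x)
        (B ((extChartAt (𝓡 n) p).symm x) (chartFrame p x v) (chartFrame p x w)))
      (extChartAt (𝓡 n) p).target := by
    apply ContMDiffOn.clm_bundle_apply₂ (F₁ := Coord n) (F₂ := Coord n)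
    · exact hB.comp_contMDiffOn (contMDiffOn_chart_symm p)
    · exact contMDiffOn_chartFrame p subset_rfl contDiffOn_const
    · exact contMDiffOn_chartFrame p subset_rfl contDiffOn_const
  intro x hx
  have h' := h x hx
  rw [Bundle.contMDiffWithinAt_totalSpace] at h'
  exact h'.2.contDiffWithinAt

end Charts


/-- Such a `v` is orthogonal to the timelike `e`, so it would be spacelike if non-zero, whereas
`g(v, v) = 0`. -/
theorem LorentzianMetric.separating {n : ℕ} {M : Type*} [TopologicalSpace M]
    [ChartedSpace (Coord n) M] [IsManifold (𝓡 n) ∞ M] (g : LorentzianMetric n M) (p : M)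
    (v : TangentSpace (𝓡 n) p) (hv : ∀ w, g.inner p v w = 0) : v = 0 := by
  obtain ⟨e, _, h⟩ := g.signature p
  by_contra hne
  have := h v (by rw [g.symm]; exact hv e) hne
  rw [hv v] at this
  exact lt_irrefl _ this

/-! ### The warped product in charts. -/

noncomputable section

namespace GRWStructure

variable {n : ℕ} {M : Type*} [TopologicalSpace M] [ChartedSpace (Coord n) M]
  [IsManifold (𝓡 n) ∞ M] {g : LorentzianMetric n M}
  {N : Type*} [TopologicalSpace N] [ChartedSpace (Coord (n - 1)) N]
  [IsManifold (𝓡 (n - 1)) ∞ N] (W : GRWStructure g N)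

/-- The time function. -/
def time (q : M) : ℝ := (W.Φ q).1

/-- The projection to the fibre. -/
def space (q : M) : N := (W.Φ q).2

theorem contMDiff_time : ContMDiff (𝓡 n) 𝓘(ℝ, ℝ) ∞ W.time :=
  contMDiff_subtype_val.comp (contMDiff_fst.comp W.Φ.contMDiff)

theorem contMDiff_space : ContMDiff (𝓡 n) (𝓡 (n - 1)) ∞ W.space :=
  contMDiff_snd.comp W.Φ.contMDiff

theorem time_mem (q : M) : W.time q ∈ W.J := (W.Φ q).1.2

/-- Chain rule for `Φ ∘ Φ⁻¹ = id`. The equation `hq` is a hypothesis because `Φ⁻¹ (Φ q)` is only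
propositionally `q`, while tangent spaces depend on the base point. -/
theorem mfderiv_Φ_symm {z : W.J × N} {q : M} (hq : q = W.Φ.symm z) (e : ℝ × Coord (n - 1)) :
    (mfderiv (𝓡 n) (𝓘(ℝ, ℝ).prod (𝓡 (n - 1))) W.Φ q
      (mfderiv (𝓘(ℝ, ℝ).prod (𝓡 (n - 1))) (𝓡 n) W.Φ.symm z e : Coord n) : ℝ × Coord (n - 1))
      = e := by
  subst hq
  have h1 : MDifferentiableAt (𝓘(ℝ, ℝ).prod (𝓡 (n - 1))) (𝓡 n) W.Φ.symm z :=
    W.Φ.symm.mdifferentiable (by simp) z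
  have h2 : MDifferentiableAt (𝓡 n) (𝓘(ℝ, ℝ).prod (𝓡 (n - 1))) W.Φ (W.Φ.symm z) :=
    W.Φ.mdifferentiable (by simp) _
  have h3 := mfderiv_comp z h2 h1
  have h4 : (W.Φ ∘ W.Φ.symm) = id := by
    ext1 z; exact W.Φ.apply_symm_apply z
  rw [h4, mfderiv_id] at h3
  exact (congrArg (fun l : ℝ × Coord (n - 1) →L[ℝ] ℝ × Coord (n - 1) => l e) h3).symm

theorem mfderiv_time (q : M) (v : TangentSpace (𝓡 n) q) :
    dirDeriv W.time q v
      = (mfderiv (𝓡 n) (𝓘(ℝ, ℝ).prod (𝓡 (n - 1))) W.Φ q v : ℝ × Coord (n - 1)).1 := by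
  have h1 := ((W.Φ.mdifferentiable (by simp)) q).hasMFDerivAt
  have h2 := (hasMFDerivAt_fst (I := 𝓘(ℝ, ℝ)) (I' := 𝓡 (n - 1)) (W.Φ q)).comp q h1
  have h3 := (hasMFDerivAt_opens_val W.J (W.Φ q).1).comp q h2
  exact congrArg (fun l : Coord n →L[ℝ] ℝ => l v) h3.mfderiv

theorem mfderiv_space (q : M) (v : TangentSpace (𝓡 n) q) :
    (mfderiv (𝓡 n) (𝓡 (n - 1)) W.space q v : Coord (n - 1))
      = (mfderiv (𝓡 n) (𝓘(ℝ, ℝ).prod (𝓡 (n - 1))) W.Φ q v : ℝ × Coord (n - 1)).2 := by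
  have h1 := ((W.Φ.mdifferentiable (by simp)) q).hasMFDerivAt
  have h2 := (hasMFDerivAt_snd (I := 𝓘(ℝ, ℝ)) (I' := 𝓡 (n - 1)) (W.Φ q)).comp q h1
  exact congrArg (fun l : Coord n →L[ℝ] Coord (n - 1) => l v) h2.mfderiv

theorem time_timeField (q : M) : dirDeriv W.time q (W.timeField q) = 1 := by
  rw [mfderiv_time]
  exact congrArg Prod.fst (W.mfderiv_Φ_symm (W.Φ.symm_apply_apply q).symm (1, 0))

theorem space_timeField (q : M) :
    (mfderiv (𝓡 n) (𝓡 (n - 1)) W.space q (W.timeField q) : Coord (n - 1)) = 0 := by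
  rw [mfderiv_space]
  exact congrArg Prod.snd (W.mfderiv_Φ_symm (W.Φ.symm_apply_apply q).symm (1, 0))

theorem inner_eq (q : M) (v w : TangentSpace (𝓡 n) q) :
    g.inner q v w = - (dirDeriv W.time q v * dirDeriv W.time q w)
      + W.a (W.time q) ^ 2 * W.h.inner (W.space q) (mfderiv (𝓡 n) (𝓡 (n - 1)) W.space q v)
          (mfderiv (𝓡 n) (𝓡 (n - 1)) W.space q w) :=
  W.metric_eq q v w

theorem inner_timeField (q : M) (v : TangentSpace (𝓡 n) q) :
    g.inner q (W.timeField q) v = - dirDeriv W.time q v := by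
  have h := W.space_timeField q
  rw [W.inner_eq, W.time_timeField, one_mul]
  have h0 : mfderiv (𝓡 n) (𝓡 (n - 1)) W.space q (W.timeField q) = 0 := h
  rw [h0]
  simp

/-- The domain of the coordinates used around `p`: the chart domain, cut down so that the fibre
component stays in a chart of the fibre. -/
def patch (p : M) : Set (Coord n) :=
  (extChartAt (𝓡 n) p).target ∩ (extChartAt (𝓡 n) p).symm ⁻¹'
    (W.space ⁻¹' (extChartAt (𝓡 (n - 1)) (W.space p)).source)

/-- The time field in the preferred chart at `p`. -/
def fieldInChart (p : M) (y : Coord n) : Coord n :=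
  let v : Coord n := W.timeField ((extChartAt (𝓡 n) p).symm y)
  (chartFrame p y).inverse v

/-- The projection to the fibre in the preferred charts. -/
def spaceInChart (p : M) (y : Coord n) : Coord (n - 1) :=
  extChartAt (𝓡 (n - 1)) (W.space p) (W.space ((extChartAt (𝓡 n) p).symm y))

theorem isOpen_patch (p : M) : IsOpen (W.patch p) :=
  (continuousOn_extChartAt_symm p).isOpen_inter_preimage (isOpen_extChartAt_target p)
    ((isOpen_extChartAt_source (I := 𝓡 (n - 1)) (W.space p)).preimage W.contMDiff_space.continuous)

theorem mem_patch (p : M) : extChartAt (𝓡 n) p p ∈ W.patch p := by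
  refine ⟨mem_extChartAt_target p, ?_⟩
  simp only [Set.mem_preimage, extChartAt_to_inv]
  exact mem_extChartAt_source _

theorem patch_subset (p : M) : W.patch p ⊆ (extChartAt (𝓡 n) p).target :=
  Set.inter_subset_left

theorem chartFrame_fieldInChart {p : M} {y : Coord n} (hy : y ∈ W.patch p) :
    chartFrame p y (W.fieldInChart p y)
      = (W.timeField ((extChartAt (𝓡 n) p).symm y) : Coord n) := by
  obtain ⟨e, he⟩ := isInvertible_chartFrame (W.patch_subset p hy)
  rw [fieldInChart, ← he, ContinuousLinearMap.inverse_equiv]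
  exact e.apply_symm_apply _

theorem contDiffOn_spaceInChart (p : M) : ContDiffOn ℝ ∞ (W.spaceInChart p) (W.patch p) := by
  have h1 : ContMDiffOn (𝓡 (n - 1)) 𝓘(ℝ, Coord (n - 1)) ∞ (extChartAt (𝓡 (n - 1)) (W.space p))
      (chartAt (Coord (n - 1)) (W.space p)).source := contMDiffOn_extChartAt
  have h2 : ContMDiffOn 𝓘(ℝ, Coord n) (𝓡 (n - 1)) ∞
      (W.space ∘ (extChartAt (𝓡 n) p).symm) (W.patch p) :=
    W.contMDiff_space.comp_contMDiffOn ((contMDiffOn_chart_symm p).mono (W.patch_subset p))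
  refine (h1.comp h2 fun y hy => ?_).contDiffOn
  rw [← extChartAt_source (𝓡 (n - 1))]
  exact hy.2

theorem spaceInChart_mem {p : M} {y : Coord n} (hy : y ∈ W.patch p) :
    W.spaceInChart p y ∈ (extChartAt (𝓡 (n - 1)) (W.space p)).target :=
  (extChartAt (𝓡 (n - 1)) (W.space p)).map_source hy.2

theorem chart_symm_spaceInChart {p : M} {y : Coord n} (hy : y ∈ W.patch p) :
    (extChartAt (𝓡 (n - 1)) (W.space p)).symm (W.spaceInChart p y)
      = W.space ((extChartAt (𝓡 n) p).symm y) :=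
  (extChartAt (𝓡 (n - 1)) (W.space p)).left_inv hy.2

/-- Chain rule for two factorisations of the same map from the patch to `N`: through `M`, and
through the fibre chart. -/
theorem chartFrame_fderiv_spaceInChart {p : M} {y : Coord n} (hy : y ∈ W.patch p)
    (v : Coord n) :
    chartFrame (W.space p) (W.spaceInChart p y) (fderiv ℝ (W.spaceInChart p) y v)
      = (mfderiv (𝓡 n) (𝓡 (n - 1)) W.space ((extChartAt (𝓡 n) p).symm y)
          (chartFrame p y v) : Coord (n - 1)) := by
  have h1 := (mdifferentiableAt_chart_symm (W.patch_subset p hy)).hasMFDerivAt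
  have h2 := ((W.contMDiff_space.mdifferentiable (by simp))
    ((extChartAt (𝓡 n) p).symm y)).hasMFDerivAt.comp y h1
  have h3 := (mdifferentiableAt_chart_symm (W.spaceInChart_mem hy)).hasMFDerivAt
  have h4 : HasMFDerivAt 𝓘(ℝ, Coord n) 𝓘(ℝ, Coord (n - 1)) (W.spaceInChart p) y
      (fderiv ℝ (W.spaceInChart p) y) :=
    (((W.contDiffOn_spaceInChart p).differentiableOn (by simp)).differentiableAt
      ((W.isOpen_patch p).mem_nhds hy)).hasFDerivAt.hasMFDerivAt
  have h5 := h3.comp y h4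
  have h6 : (W.space ∘ (extChartAt (𝓡 n) p).symm) =ᶠ[nhds y]
      ((extChartAt (𝓡 (n - 1)) (W.space p)).symm ∘ W.spaceInChart p) := by
    filter_upwards [(W.isOpen_patch p).mem_nhds hy] with z hz
    exact (W.chart_symm_spaceInChart hz).symm
  have h7 := h5.congr_of_eventuallyEq h6
  exact congrArg (fun l : Coord n →L[ℝ] Coord (n - 1) => l v) (hasMFDerivAt_unique h7 h2)

theorem bilinearInChart_fibre {p : M} {y : Coord n} (hy : y ∈ W.patch p)
    (v w : Coord n) :
    bilinearInChart W.h.inner (W.space p) (W.spaceInChart p y)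
        (fderiv ℝ (W.spaceInChart p) y v) (fderiv ℝ (W.spaceInChart p) y w)
      = W.h.inner (W.space ((extChartAt (𝓡 n) p).symm y))
          (mfderiv (𝓡 n) (𝓡 (n - 1)) W.space ((extChartAt (𝓡 n) p).symm y) (chartFrame p y v))
          (mfderiv (𝓡 n) (𝓡 (n - 1)) W.space ((extChartAt (𝓡 n) p).symm y)
            (chartFrame p y w)) := by
  have key : ∀ (z z' : N) (_ : z = z') (a a' b b' : Coord (n - 1)) (_ : a = a') (_ : b = b'),
      (W.h.inner z : Coord (n - 1) →L[ℝ] Coord (n - 1) →L[ℝ] ℝ) a b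
        = (W.h.inner z' : Coord (n - 1) →L[ℝ] Coord (n - 1) →L[ℝ] ℝ) a' b' := by
    rintro z _ rfl a _ b _ rfl rfl; rfl
  exact key _ _ (W.chart_symm_spaceInChart hy) _ _ _ _ (W.chartFrame_fderiv_spaceInChart hy v)
    (W.chartFrame_fderiv_spaceInChart hy w)

theorem inChart_apply (p : M) (y v w : Coord n) :
    g.inChart p y v w = g.inner ((extChartAt (𝓡 n) p).symm y) (chartFrame p y v)
      (chartFrame p y w) := rfl

theorem fderiv_time_chart {p : M} {y : Coord n} (hy : y ∈ W.patch p) (v : Coord n) :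
    fderiv ℝ (W.time ∘ (extChartAt (𝓡 n) p).symm) y v
      = dirDeriv W.time ((extChartAt (𝓡 n) p).symm y) (chartFrame p y v) :=
  fderiv_comp_chart_symm (W.patch_subset p hy) (W.contMDiff_time.mdifferentiable (by simp) _) v

theorem inChart_field {p : M} {y : Coord n} (hy : y ∈ W.patch p) (w : Coord n) :
    g.inChart p y (W.fieldInChart p y) w
      = - fderiv ℝ (W.time ∘ (extChartAt (𝓡 n) p).symm) y w := by
  rw [inChart_apply, W.chartFrame_fieldInChart hy, W.fderiv_time_chart hy]
  exact W.inner_timeField _ _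

theorem isInvertible_inChart {p : M} {y : Coord n} (hy : y ∈ (extChartAt (𝓡 n) p).target) :
    (g.inChart p y).IsInvertible := by
  refine isInvertible_of_separating fun v hv => ?_
  obtain ⟨e, he⟩ := isInvertible_chartFrame hy
  have h0 : (chartFrame p y v : Coord n) = 0 := by
    refine g.separating ((extChartAt (𝓡 n) p).symm y) (chartFrame p y v) fun w => ?_
    have := hv (e.symm w)
    rw [inChart_apply] at this
    rw [← this, ← he]
    exact congrArg _ (e.apply_symm_apply w).symm
  rw [← he] at h0
  exact e.injective (by simpa using h0)

/-- Every point of a generalized Robertson-Walker spacetime has a time patch. -/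
theorem timePatch (p : M) : TimePatch (W.patch p) (g.inChart p)
    (W.time ∘ (extChartAt (𝓡 n) p).symm) (W.fieldInChart p)
    (fun y => deriv W.a (W.time ((extChartAt (𝓡 n) p).symm y))
      / W.a (W.time ((extChartAt (𝓡 n) p).symm y))) := by
  have hG : ContDiffOn ℝ ∞ (g.inChart p) (W.patch p) :=
    (contDiffOn_bilinear g.contMDiff p).mono (W.patch_subset p)
  have ht : ContDiffOn ℝ ∞ (W.time ∘ (extChartAt (𝓡 n) p).symm) (W.patch p) :=
    (contDiffOn_comp_chart_symm W.contMDiff_time p).mono (W.patch_subset p)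
  have hinv : ∀ y ∈ W.patch p, (g.inChart p y).IsInvertible :=
    fun y hy => isInvertible_inChart (W.patch_subset p hy)
  have hρ : ContDiffOn ℝ ∞ (W.fieldInChart p) (W.patch p) := by
    -- Smoothness of `ρ` is read off from `ρ = -G⁻¹ dt`.
    have h1 : ContDiffOn ℝ ∞ (fun y => (g.inChart p y).inverse
        (-fderiv ℝ (W.time ∘ (extChartAt (𝓡 n) p).symm) y)) (W.patch p) := by
      refine ContDiffOn.clm_apply (fun y hy => ?_)
        (ht.fderiv_of_isOpen (W.isOpen_patch p) (by simp)).neg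
      exact ((hinv y hy).contDiffAt_map_inverse).comp_contDiffWithinAt y (hG y hy)
    refine h1.congr fun y hy => ?_
    obtain ⟨e, he⟩ := hinv y hy
    have h2 : g.inChart p y (W.fieldInChart p y)
        = -fderiv ℝ (W.time ∘ (extChartAt (𝓡 n) p).symm) y := by
      ext w
      simpa using W.inChart_field hy w
    rw [← h2, ← he]
    simp
  have htime : ∀ y ∈ W.patch p, fderiv ℝ (W.time ∘ (extChartAt (𝓡 n) p).symm) y
      (W.fieldInChart p y) = 1 := by
    intro y hy
    rw [W.fderiv_time_chart hy, W.chartFrame_fieldInChart hy]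
    exact W.time_timeField _
  refine ⟨W.isOpen_patch p, hG, ht, hρ, fun y _ v w => g.symm _ _ _, hinv,
    fun y hy w => W.inChart_field hy w, htime, fun y hy u w => ?_⟩
  have hJ : ∀ y, (W.J : Set ℝ) ∈ nhds (W.time ((extChartAt (𝓡 n) p).symm y)) :=
    fun y => W.J.isOpen.mem_nhds (W.time_mem _)
  refine lie_warped (h := bilinearInChart W.h.inner (W.space p)) (π := W.spaceInChart p)
    (W.isOpen_patch p) (hG.differentiableOn (by simp)) ht
    (W.contDiffOn_spaceInChart p) (hρ.differentiableOn (by simp)) (fun y hy => ?_)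
    (fun y _ => ?_) (fun y _ => ?_) (fun y hy v w => ?_) htime (fun y hy => ?_) hy u w
  · exact ((contDiffOn_bilinear W.h.contMDiff (W.space p)).differentiableOn
      (by simp)).differentiableAt ((isOpen_extChartAt_target _).mem_nhds (W.spaceInChart_mem hy))
  · exact (W.a_smooth.differentiableOn (by simp)).differentiableAt (hJ y)
  · exact (W.a_pos _ (W.time_mem _)).ne'
  · rw [inChart_apply, W.bilinearInChart_fibre hy, W.fderiv_time_chart hy, W.fderiv_time_chart hy]
    exact W.inner_eq _ _ _
  · obtain ⟨e, he⟩ := isInvertible_chartFrame (W.spaceInChart_mem hy)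
    have h1 := W.chartFrame_fderiv_spaceInChart hy (W.fieldInChart p y)
    rw [W.chartFrame_fieldInChart hy, ← he] at h1
    exact e.injective ((h1.trans (W.space_timeField _)).trans (map_zero e).symm)

end GRWStructure

end


noncomputable section

/-! ### From chart centres back to points of the manifold. -/

section Centre

variable {n : ℕ} {M : Type*} [TopologicalSpace M] [ChartedSpace (Coord n) M]
  [IsManifold (𝓡 n) ∞ M]

theorem inChart_centre (g : LorentzianMetric n M) (p : M) (v w : TangentSpace (𝓡 n) p) :
    g.inChart p (extChartAt (𝓡 n) p p) v w = g.inner p v w := by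
  have key : ∀ (q : M) (_ : q = p) (a b : Coord n),
      (g.inner q : Coord n →L[ℝ] Coord n →L[ℝ] ℝ) a b
        = (g.inner p : Coord n →L[ℝ] Coord n →L[ℝ] ℝ) a b := by
    rintro q rfl a b; rfl
  have h := GRWStructure.inChart_apply (g := g) p (extChartAt (𝓡 n) p p) v w
  rw [chartFrame_self] at h
  exact h.trans (key _ (extChartAt_to_inv p) v w)

theorem fderiv_centre {f : M → ℝ} (hf : ContMDiff (𝓡 n) 𝓘(ℝ, ℝ) ∞ f) (p : M)
    (v : TangentSpace (𝓡 n) p) :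
    fderiv ℝ (f ∘ (extChartAt (𝓡 n) p).symm) (extChartAt (𝓡 n) p p) v = dirDeriv f p v := by
  have key : ∀ (q : M) (_ : q = p) (a : Coord n), dirDeriv f q a = dirDeriv f p a := by
    rintro q rfl a; rfl
  have h := fderiv_comp_chart_symm (mem_extChartAt_target p) (hf.mdifferentiable (by simp) _) v
  rw [chartFrame_self] at h
  exact h.trans (key _ (extChartAt_to_inv p) v)

end Centre

/-! ### Ricci, Hessian and soliton potential on the whole spacetime. -/

namespace GRWStructure

variable {n : ℕ} {M : Type*} [TopologicalSpace M] [ChartedSpace (Coord n) M]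
  [IsManifold (𝓡 n) ∞ M] {g : LorentzianMetric n M}
  {N : Type*} [TopologicalSpace N] [ChartedSpace (Coord (n - 1)) N]
  [IsManifold (𝓡 (n - 1)) ∞ N] (W : GRWStructure g N)

/-- The Hubble function `a' / a`. -/
def hubble (s : ℝ) : ℝ := deriv W.a s / W.a s

theorem contDiffOn_hubble : ContDiffOn ℝ ∞ W.hubble W.J :=
  (W.a_smooth.deriv_of_isOpen W.J.isOpen (by simp)).div W.a_smooth fun s hs => (W.a_pos s hs).ne'

theorem fieldInChart_centre (p : M) :
    W.fieldInChart p (extChartAt (𝓡 n) p p) = (W.timeField p : Coord n) := by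
  have key : ∀ (q : M) (_ : q = p), (W.timeField q : Coord n) = W.timeField p := by
    rintro q rfl; rfl
  have h := W.chartFrame_fieldInChart (W.mem_patch p)
  rw [chartFrame_self] at h
  exact h.trans (key _ (extChartAt_to_inv p))

theorem contMDiff_timeField : ContMDiff (𝓡 n) (𝓡 n).tangent ∞
    (fun p => (⟨p, W.timeField p⟩ : TangentBundle (𝓡 n) M)) := by
  intro p
  have h1 := contMDiffOn_chartFrame p (W.patch_subset p) (W.timePatch p).contDiffOn_field
  have h2 := h1.contMDiffAt ((W.isOpen_patch p).mem_nhds (W.mem_patch p))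
  have h3 : ContMDiffAt (𝓡 n) 𝓘(ℝ, Coord n) ∞ (extChartAt (𝓡 n) p) p := contMDiffAt_extChartAt
  refine (h2.comp p h3).congr_of_eventuallyEq ?_
  have h4 : ∀ᶠ q in nhds p, extChartAt (𝓡 n) p q ∈ W.patch p :=
    h3.continuousAt ((W.isOpen_patch p).mem_nhds (W.mem_patch p))
  filter_upwards [h4, extChartAt_source_mem_nhds (I := 𝓡 n) p] with q hq hq'
  have key : ∀ (q' : M) (_ : q' = q) (v : Coord n) (_ : v = (W.timeField q' : Coord n)),
      (⟨q, W.timeField q⟩ : TangentBundle (𝓡 n) M) = ⟨q', v⟩ := by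
    rintro q' rfl v rfl; rfl
  exact key _ ((extChartAt (𝓡 n) p).left_inv hq') _ (W.chartFrame_fieldInChart hq)

theorem time_centre (p : M) :
    W.time ((extChartAt (𝓡 n) p).symm (extChartAt (𝓡 n) p p)) = W.time p := by
  rw [extChartAt_to_inv]

/-- The Ricci curvature in the time direction, `S(v, ρ) = (n - 1) (a'' / a) η(v)`. -/
theorem ricci_timeField (p : M) (v : TangentSpace (𝓡 n) p) :
    g.ricci p v (W.timeField p) = - ((n - 1) *
      (deriv W.hubble (W.time p) + W.hubble (W.time p) ^ 2) * dirDeriv W.time p v) := by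
  have P := W.timePatch p
  have hx := W.mem_patch p
  have hd : HasDerivAt W.hubble (deriv W.hubble (W.time p))
      ((W.time ∘ (extChartAt (𝓡 n) p).symm) (extChartAt (𝓡 n) p p)) := by
    rw [Function.comp_apply, W.time_centre]
    exact ((W.contDiffOn_hubble.differentiableOn (by simp)).differentiableAt
      (W.J.isOpen.mem_nhds (W.time_mem p))).hasDerivAt
  have h := P.ricciCoord_field hx (hd.comp_hasFDerivAt (extChartAt (𝓡 n) p p) (P.hasFDerivAt_time hx)) v
  rw [fieldInChart_centre, fderiv_centre W.contMDiff_time, W.time_centre] at h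
  exact h

theorem hess_timeField {f : M → ℝ} (hf : ContMDiff (𝓡 n) 𝓘(ℝ, ℝ) ∞ f) {c : ℝ}
    (hc : ∀ p : M, dirDeriv f p (W.timeField p) = c) (p : M) (v : TangentSpace (𝓡 n) p) :
    g.hess f p v (W.timeField p)
      = - (W.hubble (W.time p) * (dirDeriv f p v - c * dirDeriv W.time p v)) := by
  have P := W.timePatch p
  have hx := W.mem_patch p
  have hF := (contDiffOn_comp_chart_symm hf p).mono (W.patch_subset p)
  have h := P.hessCoord_field hF (c := c) (fun y hy => ?_) hx v
  · rw [fieldInChart_centre, fderiv_centre W.contMDiff_time, fderiv_centre hf,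
      W.time_centre] at h
    exact h
  · rw [fderiv_comp_chart_symm (W.patch_subset p hy) (hf.mdifferentiable (by simp) _),
      W.chartFrame_fieldInChart hy]
    exact hc _

theorem hess_of_dirDeriv_eq {f : M → ℝ} (hf : ContMDiff (𝓡 n) 𝓘(ℝ, ℝ) ∞ f) {c : ℝ}
    (hc : ∀ (p : M) (v : TangentSpace (𝓡 n) p), dirDeriv f p v = c * dirDeriv W.time p v)
    (p : M) (v w : TangentSpace (𝓡 n) p) :
    g.hess f p v w = - (c * W.hubble (W.time p)
      * (g.inner p v w + dirDeriv W.time p v * dirDeriv W.time p w)) := by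
  have P := W.timePatch p
  have hx := W.mem_patch p
  have h := P.hessCoord_of_fderiv_eq (F := f ∘ (extChartAt (𝓡 n) p).symm) (c := c)
    (fun y hy u => ?_) hx v w
  · rw [fderiv_centre W.contMDiff_time, fderiv_centre W.contMDiff_time, inChart_centre,
      W.time_centre] at h
    exact h
  · rw [fderiv_comp_chart_symm (W.patch_subset p hy) (hf.mdifferentiable (by simp) _),
      W.fderiv_time_chart hy]
    exact hc _ _

theorem timeField_Φ_symm (z : W.J × N) :
    (mfderiv (𝓘(ℝ, ℝ).prod (𝓡 (n - 1))) (𝓡 n) W.Φ.symm z ((1 : ℝ), (0 : Coord (n - 1))) : Coord n)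
      = W.timeField (W.Φ.symm z) := by
  have key : ∀ (z' : W.J × N) (_ : z' = z),
      (mfderiv (𝓘(ℝ, ℝ).prod (𝓡 (n - 1))) (𝓡 n) W.Φ.symm z
        ((1 : ℝ), (0 : Coord (n - 1))) : Coord n)
      = (mfderiv (𝓘(ℝ, ℝ).prod (𝓡 (n - 1))) (𝓡 n) W.Φ.symm z'
        ((1 : ℝ), (0 : Coord (n - 1))) : Coord n) := by
    rintro z' rfl; rfl
  exact key _ (W.Φ.apply_symm_apply z)

/-- A function whose derivative along `ρ` is the constant `c` is affine along the time lines. -/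
theorem affine_along_time {f : M → ℝ} (hf : ContMDiff (𝓡 n) 𝓘(ℝ, ℝ) ∞ f) {c : ℝ}
    (hc : ∀ p : M, dirDeriv f p (W.timeField p) = c) (s s₀ : W.J) (y : N) :
    f (W.Φ.symm (s, y)) - c * s = f (W.Φ.symm (s₀, y)) - c * s₀ := by
  classical
  let k : W.J → ℝ := fun s => f (W.Φ.symm (s, y))
  -- The velocity of `s ↦ Φ⁻¹(s, y)` is `ρ`, so the derivative of `k` is `ρ f = c`.
  have hk : ∀ s : W.J, HasMFDerivAt 𝓘(ℝ, ℝ) 𝓘(ℝ, ℝ) k s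
      (ContinuousLinearMap.toSpanSingleton ℝ c) := by
    intro s
    have h1 : MDifferentiableAt 𝓘(ℝ, ℝ) (𝓘(ℝ, ℝ).prod (𝓡 (n - 1))) (fun s : W.J => (s, y)) s :=
      mdifferentiableAt_id.prodMk mdifferentiableAt_const
    have h2 := ((hf.mdifferentiable (by simp)) _).hasMFDerivAt.comp s
      (((W.Φ.symm.mdifferentiable (by simp)) (s, y)).hasMFDerivAt.comp s h1.hasMFDerivAt)
    refine h2.congr_mfderiv ?_
    rw [mfderiv_prod_left]
    refine ContinuousLinearMap.ext_ring ?_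
    refine Eq.trans ?_ ((hc (W.Φ.symm (s, y))).trans (one_smul ℝ c).symm)
    exact congrArg (mfderiv (𝓡 n) 𝓘(ℝ, ℝ) f (W.Φ.symm (s, y))) (W.timeField_Φ_symm (s, y))
  -- Extension to `ℝ`, so that real calculus on the interval applies; the value 0 off the open set
  -- `J` is irrelevant.
  let K : ℝ → ℝ := fun σ => if h : σ ∈ W.J then k ⟨σ, h⟩ - c * σ else 0
  have hK : ∀ σ ∈ (W.J : Set ℝ), HasDerivAt K 0 σ := by
    intro σ hσ
    have h1 := (hk ⟨σ, hσ⟩).2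
    rw [ModelWithCorners.range_eq_univ] at h1
    have h2 : HasFDerivAt (fun z => writtenInExtChartAt 𝓘(ℝ, ℝ) 𝓘(ℝ, ℝ) (⟨σ, hσ⟩ : W.J) k z)
        (ContinuousLinearMap.toSpanSingleton ℝ c : ℝ →L[ℝ] ℝ) σ :=
      h1.hasFDerivAt Filter.univ_mem
    have h3 := h2.hasDerivAt.sub ((hasDerivAt_id σ).const_mul c)
    simp only [ContinuousLinearMap.toSpanSingleton_apply, one_smul, mul_one, sub_self] at h3
    refine h3.congr_of_eventuallyEq ?_
    filter_upwards [(isOpen_extChartAt_target (I := 𝓘(ℝ, ℝ)) (⟨σ, hσ⟩ : W.J)).mem_nhds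
      (mem_extChartAt_target (I := 𝓘(ℝ, ℝ)) (⟨σ, hσ⟩ : W.J)), W.J.isOpen.mem_nhds hσ] with z hz hz'
    have h4 : (extChartAt 𝓘(ℝ, ℝ) (⟨σ, hσ⟩ : W.J)).symm z = ⟨z, hz'⟩ :=
      Subtype.ext ((extChartAt 𝓘(ℝ, ℝ) (⟨σ, hσ⟩ : W.J)).right_inv hz)
    have h5 : writtenInExtChartAt 𝓘(ℝ, ℝ) 𝓘(ℝ, ℝ) (⟨σ, hσ⟩ : W.J) k z = k ⟨z, hz'⟩ :=
      congrArg k h4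
    have h6 : K z = k ⟨z, hz'⟩ - c * z := dif_pos hz'
    rw [h6, ← h5]
    rfl
  have h := W.J.isOpen.is_const_of_deriv_eq_zero W.ordConnected.isPreconnected
    (fun σ hσ => (hK σ hσ).differentiableAt.differentiableWithinAt)
    (fun σ hσ => (hK σ hσ).deriv) s.2 s₀.2
  have hs : ∀ s : W.J, K s = k s - c * s := fun s => dif_pos s.2
  rw [hs, hs] at h
  exact h

/-- If `ρ f = c` and `df = c dt` on one slice, then `df = c dt` everywhere. -/
theorem dirDeriv_eq_of_slice {f : M → ℝ} (hf : ContMDiff (𝓡 n) 𝓘(ℝ, ℝ) ∞ f) {c : ℝ}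
    (hc : ∀ p : M, dirDeriv f p (W.timeField p) = c) (s₀ : W.J)
    (hs₀ : ∀ p : M, W.time p = s₀ → ∀ v : TangentSpace (𝓡 n) p,
      dirDeriv f p v = c * dirDeriv W.time p v)
    (q : M) (v : TangentSpace (𝓡 n) q) : dirDeriv f q v = c * dirDeriv W.time q v := by
  -- Retraction of `M` onto the slice `t = s₀` along the time lines; then `f = f ∘ r + c (t - s₀)`.
  let r : M → M := fun q => W.Φ.symm (s₀, W.space q)
  have hr : ContMDiff (𝓡 n) (𝓡 n) ∞ r :=
    W.Φ.symm.contMDiff.comp (contMDiff_const.prodMk W.contMDiff_space)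
  have hrt : ∀ q, W.time (r q) = s₀ := fun q => by
    simp only [time, r, W.Φ.apply_symm_apply]
  have hfr : f = f ∘ r + (c • W.time - fun _ => c * (s₀ : ℝ)) := by
    funext q
    have h := W.affine_along_time hf hc (W.Φ q).1 s₀ (W.space q)
    have h' : W.Φ.symm ((W.Φ q).1, W.space q) = q := W.Φ.symm_apply_apply q
    rw [h'] at h
    simp only [Pi.add_apply, Pi.sub_apply, Pi.smul_apply, Function.comp_apply, smul_eq_mul, r,
      time]
    linarith
  have h1 := ((hr.mdifferentiable (by simp)) q).hasMFDerivAt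
  have h2 := ((hf.mdifferentiable (by simp)) (r q)).hasMFDerivAt.comp q h1
  have h3 := ((W.contMDiff_time.mdifferentiable (by simp)) (r q)).hasMFDerivAt.comp q h1
  have h4 := ((W.contMDiff_time.mdifferentiable (by simp)) q).hasMFDerivAt
  have h5 := h2.add ((h4.const_smul c).sub (hasMFDerivAt_const (I := 𝓡 n) (I' := 𝓘(ℝ, ℝ))
    (c * (s₀ : ℝ)) q))
  rw [← hfr] at h5
  have h6 : (W.time ∘ r) = fun _ => (s₀ : ℝ) := funext hrt
  rw [h6] at h3
  -- The image of `dr` is tangent to the slice, so `dt`, and by `hs₀` also `df`, vanishes on it.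
  have h7 : dirDeriv W.time (r q) (mfderiv (𝓡 n) (𝓡 n) r q v) = 0 :=
    congrArg (fun l : Coord n →L[ℝ] ℝ => l v)
      (hasMFDerivAt_unique h3 (hasMFDerivAt_const (I := 𝓡 n) (I' := 𝓘(ℝ, ℝ)) (s₀ : ℝ) q))
  have h8 := hs₀ (r q) (hrt q) (mfderiv (𝓡 n) (𝓡 n) r q v)
  rw [h7, mul_zero] at h8
  have h9 : dirDeriv f q v = dirDeriv f (r q) (mfderiv (𝓡 n) (𝓡 n) r q v)
      + (c * dirDeriv W.time q v - 0) :=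
    congrArg (fun l : Coord n →L[ℝ] ℝ => l v) h5.mfderiv
  rw [h9, h8]
  ring

end GRWStructure

end

end GRW

/-! ### The soliton equation forces the perfect-fluid form. -/

theorem mainTheorem6 {n : ℕ} (hn : 4 ≤ n)
    {M : Type*} [TopologicalSpace M] [ChartedSpace (GRW.Coord n) M] [IsManifold (𝓡 n) ∞ M]
    (g : GRW.LorentzianMetric n M)
    {N : Type*} [TopologicalSpace N] [ChartedSpace (GRW.Coord (n - 1)) N]
    [IsManifold (𝓡 (n - 1)) ∞ N] (W : GRW.GRWStructure g N)
    (hξ : ∃ (p : M) (v : TangentSpace (𝓡 n) p), g.ricci p v (W.timeField p) ≠ 0)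
    (f : M → ℝ) (lam τ : ℝ) (hf : GRW.IsGradientTauEinsteinSoliton g f lam τ)
    (c : ℝ) (hc : ∀ p : M, GRW.dirDeriv f p (W.timeField p) = c) :
    GRW.IsPerfectFluid g W.timeField := by
  obtain ⟨hfs, hsol⟩ := hf
  have hη : ∀ (p : M) (v : TangentSpace (𝓡 n) p),
      g.inner p v (W.timeField p) = - GRW.dirDeriv W.time p v := fun p v => by
    rw [g.symm]; exact W.inner_timeField p v
  have hρ : ∀ (p : M) (v : TangentSpace (𝓡 n) p),
      - (W.hubble (W.time p) * (GRW.dirDeriv f p v - c * GRW.dirDeriv W.time p v))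
      + - ((n - 1) * (deriv W.hubble (W.time p) + W.hubble (W.time p) ^ 2)
        * GRW.dirDeriv W.time p v)
      = (lam + τ * g.scalar p) * (- GRW.dirDeriv W.time p v) := fun p v => by
    rw [← W.hess_timeField hfs hc, ← W.ricci_timeField, ← hη]
    exact hsol p v (W.timeField p)
  -- At `v = ρ` the Hessian term vanishes, because `df(ρ) = c` and `dt(ρ) = 1`.
  have hlam : ∀ p : M, lam + τ * g.scalar p
      = (n - 1) * (deriv W.hubble (W.time p) + W.hubble (W.time p) ^ 2) := fun p => by
    have h := hρ p (W.timeField p)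
    rw [hc, W.time_timeField] at h
    linarith
  have hspatial : ∀ (p : M) (v : TangentSpace (𝓡 n) p),
      W.hubble (W.time p) * (GRW.dirDeriv f p v - c * GRW.dirDeriv W.time p v) = 0 :=
    fun p v => by
      have h := hρ p v
      rw [hlam] at h
      linarith
  -- If `H` vanished on the open interval `J`, so would `H'`, and then `S(·, ρ) = 0` everywhere.
  obtain ⟨s₀, hs₀⟩ : ∃ s : W.J, W.hubble s ≠ 0 := by
    by_contra! h0
    obtain ⟨p, v, hpv⟩ := hξ
    apply hpv
    have h1 : W.hubble =ᶠ[nhds (W.time p)] fun _ => 0 := by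
      filter_upwards [W.J.isOpen.mem_nhds (W.time_mem p)] with s hs using h0 ⟨s, hs⟩
    rw [W.ricci_timeField, h1.deriv_eq, h1.self_of_nhds]
    simp
  have hdf : ∀ (p : M) (v : TangentSpace (𝓡 n) p),
      GRW.dirDeriv f p v = c * GRW.dirDeriv W.time p v := by
    refine W.dirDeriv_eq_of_slice hfs hc s₀ fun p hp v => ?_
    have h := hspatial p v
    rw [hp] at h
    exact sub_eq_zero.1 ((mul_eq_zero.1 h).resolve_left hs₀)
  have hsmooth : ∀ {F : ℝ → ℝ}, ContDiffOn ℝ ∞ F W.J →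
      ContMDiff (𝓡 n) 𝓘(ℝ, ℝ) ∞ (fun p => F (W.time p)) := fun hF =>
    hF.contMDiffOn.comp_contMDiff W.contMDiff_time W.time_mem
  have hH := W.contDiffOn_hubble
  have hH' : ContDiffOn ℝ ∞ (deriv W.hubble) W.J := hH.deriv_of_isOpen W.J.isOpen (by simp)
  -- In `a₁ = lam + τ r + cH` the term `lam + τ r` is replaced by its value from `hlam`, so both
  -- coefficients are smooth functions of `t` and the smoothness of `r` is not needed.
  refine ⟨W.contMDiff_timeField, fun p => by rw [W.inner_timeField, W.time_timeField],
    hξ.imp fun p ⟨v, hv⟩ => ⟨v, _, hv⟩,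
    fun p => (n - 1) * (deriv W.hubble (W.time p) + W.hubble (W.time p) ^ 2)
      + c * W.hubble (W.time p), fun p => c * W.hubble (W.time p), ?_, ?_, fun p v w => ?_⟩
  · exact hsmooth (F := fun s => (n - 1) * (deriv W.hubble s + W.hubble s ^ 2) + c * W.hubble s)
      ((contDiffOn_const.mul (hH'.add (hH.pow 2))).add (contDiffOn_const.mul hH))
  · exact hsmooth (F := fun s => c * W.hubble s) (contDiffOn_const.mul hH)
  · have h := hsol p v w
    rw [hlam, W.hess_of_dirDeriv_eq hfs hdf] at h
    rw [hη, hη]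
    linear_combination h
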